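/- Let $\mathcal{D}$ be a triangulated category with (set-indexed) coproducts, and write $\mathcal{X}^{\perp}$ for the class of objects $Y$ with $\mathrm{Hom}_{\mathcal{D}}(X,Y)=0$ for all $X\in\mathcal{X}$. Let $(\mathcal{U},\mathcal{U}^{\perp}[1])$ be a compactly generated t-structure on $\mathcal{D}$, that is, a t-structure for which there is a set $\mathcal{S}\subseteq\mathcal{U}$ of compact objects of $\mathcal{D}$ (objects $S$ such that $\mathrm{Hom}_{\mathcal{D}}(S,-)$, with values in abelian groups, preserves coproducts) such that $\mathcal{U}^{\perp}$ consists precisely of the objects $Y$ with $\mathrm{Hom}_{\mathcal{D}}(S[k],Y)=0$ for all $S\in\mathcal{S}$ and all integers $k\geq 0$. Then countable direct limits are exact in the heart $\mathcal{H}=\mathcal{U}\cap\mathcal{U}^{\perp}[1]$. That is, $\mathcal{H}$ is an abelian category, and for every countable (nonempty) directed set $I$, every direct system $I\to\mathcal{H}$ has a direct limit in $\mathcal{H}$ and the functor $\varinjlim_I:[I,\mathcal{H}]\to\mathcal{H}$ is exact. -/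

import Mathlib

open CategoryTheory CategoryTheory.Limits

universe w v u

namespace CompactlyGeneratedHeart

/-- An object `S` of an additive category with coproducts is compact if the functor
`Hom(S, -)`, with values in abelian groups, preserves (set-indexed) coproducts. -/
def IsCompactObject {D : Type u} [Category.{v} D] [Preadditive D] (S : D) : Prop :=
  ∀ J : Type v,
    PreservesColimitsOfShape (Discrete J) (preadditiveCoyoneda.obj (Opposite.op S))

section

variable {D : Type u} [Category.{v} D] [Preadditive D] [HasZeroObject D] [HasShift D ℤ]
  [∀ n : ℤ, (shiftFunctor D n).Additive] [Pretriangulated D]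

/-- The aisle `𝒰` of a t-structure. The t-structure itself is the pair `(𝒰, 𝒰^⊥[1])`, where
`𝒰 = t.le 0`, `𝒰^⊥ = t.ge 1` and `𝒰^⊥[1] = t.ge 0`. -/
def aisle (t : Triangulated.TStructure D) : ObjectProperty D := t.le 0

/-- The t-structure `t` is generated by a class `S` of objects of its aisle `𝒰`:
`𝒰^⊥` consists precisely of the objects `Y` such that `Hom(X[k], Y) = 0` for all `X` in `S`
and all integers `k ≥ 0`. -/
def IsGeneratedBy (t : Triangulated.TStructure D) (S : ObjectProperty D) : Prop :=
  S ≤ aisle t ∧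
    ∀ Y : D, (aisle t).rightOrthogonal Y ↔
      ∀ X : D, S X → ∀ k : ℤ, 0 ≤ k → ∀ f : X⟦k⟧ ⟶ Y, f = 0

/-- The t-structure `t` is compactly generated: it is generated by a (small) set of
compact objects of its aisle. -/
def IsCompactlyGenerated (t : Triangulated.TStructure D) : Prop :=
  ∃ S : ObjectProperty D, ObjectProperty.Small.{v} S ∧
    (∀ X : D, S X → IsCompactObject X) ∧ IsGeneratedBy t S

end

/-- The category `A` has a structure of abelian category whose additive structure is the
given one. -/
def IsAbelianCategory (A : Type u) [Category.{v} A] [P : Preadditive A] : Prop :=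
  ∃ a : Abelian A, a.toPreadditive = P

/-- `I`-colimits are exact in `A`: `A` has `I`-colimits and the functor
`colim : (I ⥤ A) ⥤ A` is exact (left exact and right exact). -/
def ColimitsAreExact (I : Type w) [Category.{w} I] (A : Type u) [Category.{v} A] : Prop :=
  ∃ _ : HasColimitsOfShape I A,
    PreservesFiniteLimits (colim : (I ⥤ A) ⥤ A) ∧
      PreservesFiniteColimits (colim : (I ⥤ A) ⥤ A)

end CompactlyGeneratedHeart

/-! For a sequence `F` in the heart, take the Milnor triangle `∐ F ⟶ ∐ F ⟶ M` on `1 - s`. A map from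
a compact object has finitely many nonzero components, so `1 - s` is injective on `Hom(S[k], -)` for
every `k`, and maps `S[k] ⟶ M` lift to `∐ F`. This puts `M` in the heart
(`heart_of_milnorMap_distTriang`), so `M` is the cokernel of `1 - s` there, i.e. the colimit of `F`.
The same triangle shows that `Hom(S, -)` commutes with this colimit for each generator `S`
(`exists_isColimit_sequence`).

Generators detect monomorphisms of the heart (`mono_of_forall_generator`), so sequential colimits
preserve them; being right exact, they are exact. A countable directed set receives a final functor
from `ℕ`. -/

namespace CompactlyGeneratedHeart

/-! ### Small objects, countable coproducts and the Milnor map -/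

section Coproducts

variable {A : Type u} [Category.{v} A] [Preadditive A]

/-- Any morphism from `S` to a coproduct of a sequence of objects factors through a finite
subcoproduct. -/
def IsSequentiallySmall (S : A) : Prop :=
  ∀ ⦃X : ℕ → A⦄ (c : Cofan X) (_ : IsColimit c) (f : S ⟶ c.pt),
    ∃ (s : Finset ℕ) (g : ∀ n, S ⟶ X n), f = ∑ n ∈ s, g n ≫ c.inj n

lemma IsCompactObject.isSequentiallySmall {S : A} (hS : IsCompactObject S) :
    IsSequentiallySmall S := by
  intro X c hc f
  have : PreservesColimitsOfShape (Discrete ℕ) (preadditiveCoyoneda.obj (Opposite.op S)) :=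
    have := hS (ULift.{v} ℕ)
    preservesColimitsOfShape_of_equiv (Discrete.equivalence Equiv.ulift) _
  let φ : DirectSum ℕ (fun n ↦ S ⟶ X n) →+ (S ⟶ c.pt) :=
    DirectSum.toAddMonoid (fun n ↦ Preadditive.rightComp S (c.inj n))
  let hc' := isColimitOfPreserves (preadditiveCoyoneda.obj (Opposite.op S)) hc
  -- Surjectivity of `φ`: the quotient by its range kills every leg of the preserved coproduct,
  -- hence is zero.
  have hq : AddCommGrpCat.ofHom (QuotientAddGroup.mk' φ.range) =
      (0 : (preadditiveCoyoneda.obj (Opposite.op S)).obj c.pt ⟶ _) := by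
    refine hc'.hom_ext (fun ⟨n⟩ ↦ ?_)
    ext (x : S ⟶ X n)
    exact (QuotientAddGroup.eq_zero_iff _).2
      ⟨DirectSum.of _ n x, by simp [φ, Preadditive.rightComp]; rfl⟩
  obtain ⟨x, hx⟩ : f ∈ φ.range := by
    rw [← QuotientAddGroup.eq_zero_iff]
    exact ConcreteCategory.congr_hom hq f
  classical
  refine ⟨DFinsupp.support x, x, ?_⟩
  rw [← hx]
  dsimp only [φ, DirectSum.toAddMonoid]
  rw [DFinsupp.liftAddHom_apply, DFinsupp.sumAddHom_apply, DFinsupp.sum]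
  rfl

/-- The projections of a coproduct in a preadditive category. -/
noncomputable def coproductProj {X : ℕ → A} {c : Cofan X} (hc : IsColimit c) (n : ℕ) :
    c.pt ⟶ X n :=
  Cofan.IsColimit.desc hc (fun m ↦ if h : m = n then eqToHom (by rw [h]) else 0)

@[simp]
lemma inj_coproductProj_self {X : ℕ → A} {c : Cofan X} (hc : IsColimit c) (n : ℕ) :
    c.inj n ≫ coproductProj hc n = 𝟙 _ := by
  simp [coproductProj]

lemma inj_coproductProj_of_ne {X : ℕ → A} {c : Cofan X} (hc : IsColimit c) {m n : ℕ}
    (h : m ≠ n) : c.inj m ≫ coproductProj hc n = 0 := by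
  simp [coproductProj, h]

namespace IsSequentiallySmall

variable {S : A} (hS : IsSequentiallySmall S) {X : ℕ → A} {c : Cofan X} (hc : IsColimit c)

include hS

/-- A coproduct need not embed in a product, but finiteness of the support makes the projections
jointly injective on maps from `S`. -/
lemma eq_zero_of_comp_coproductProj (f : S ⟶ c.pt) (hf : ∀ n, f ≫ coproductProj hc n = 0) :
    f = 0 := by
  obtain ⟨s, g, hg⟩ := hS c hc f
  rw [hg]
  refine Finset.sum_eq_zero (fun n hn ↦ ?_)
  suffices g n = 0 by rw [this, zero_comp]
  rw [← hf n, hg, Preadditive.sum_comp, Finset.sum_eq_single_of_mem n hn]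
  · simp
  · intro m _ hmn
    rw [Category.assoc, inj_coproductProj_of_ne hc hmn, comp_zero]

lemma exists_forall_comp_coproductProj_eq_zero (f : S ⟶ c.pt) :
    ∃ N, ∀ n, N ≤ n → f ≫ coproductProj hc n = 0 := by
  obtain ⟨s, g, hg⟩ := hS c hc f
  refine ⟨s.sup id + 1, fun n hn ↦ ?_⟩
  rw [hg, Preadditive.sum_comp]
  refine Finset.sum_eq_zero (fun m hm ↦ ?_)
  have : m ≤ s.sup id := Finset.le_sup (f := id) hm
  rw [Category.assoc, inj_coproductProj_of_ne hc (by lia), comp_zero]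

end IsSequentiallySmall

/-- If `c` is a coproduct of the objects `F.obj n`, this is the endomorphism `1 - s` of `c.pt`,
where `s` is induced by the transition maps `F.obj n ⟶ F.obj (n + 1)`. -/
noncomputable def milnorMap (F : ℕ ⥤ A) {c : Cofan F.obj} (hc : IsColimit c) : c.pt ⟶ c.pt :=
  Cofan.IsColimit.desc hc (fun n ↦ c.inj n - F.map (homOfLE n.le_succ) ≫ c.inj (n + 1))

section

variable (F : ℕ ⥤ A) {c : Cofan F.obj} (hc : IsColimit c)

@[simp]
lemma inj_milnorMap (n : ℕ) :
    c.inj n ≫ milnorMap F hc = c.inj n - F.map (homOfLE n.le_succ) ≫ c.inj (n + 1) := by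
  simp [milnorMap]

lemma inj_milnorMap_assoc (n : ℕ) {M : A} (q : c.pt ⟶ M) :
    c.inj n ≫ milnorMap F hc ≫ q =
      (c.inj n - F.map (homOfLE n.le_succ) ≫ c.inj (n + 1)) ≫ q := by
  rw [← Category.assoc, inj_milnorMap]

lemma milnorMap_coproductProj_zero :
    milnorMap F hc ≫ coproductProj hc 0 = coproductProj hc 0 := by
  refine Cofan.IsColimit.hom_ext hc _ _ (fun n ↦ ?_)
  rw [inj_milnorMap_assoc, Preadditive.sub_comp, Category.assoc,
    inj_coproductProj_of_ne hc (Nat.succ_ne_zero n), comp_zero, sub_zero]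

lemma milnorMap_coproductProj_succ (m : ℕ) :
    milnorMap F hc ≫ coproductProj hc (m + 1) =
      coproductProj hc (m + 1) - coproductProj hc m ≫ F.map (homOfLE m.le_succ) := by
  refine Cofan.IsColimit.hom_ext hc _ _ (fun n ↦ ?_)
  rw [inj_milnorMap_assoc, Preadditive.sub_comp, Category.assoc, Preadditive.comp_sub]
  congr 1
  by_cases h : n = m
  · subst h
    rw [inj_coproductProj_self, Category.comp_id, ← Category.assoc, inj_coproductProj_self,
      Category.id_comp]
  · rw [inj_coproductProj_of_ne hc (by lia), comp_zero, ← Category.assoc,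
      inj_coproductProj_of_ne hc h, zero_comp]

/-- If `x` is killed by `1 - s`, its components satisfy `x₀ = 0` and `xₙ₊₁ = xₙ ≫ F(n → n+1)`, so
all vanish. -/
lemma IsSequentiallySmall.eq_zero_of_comp_milnorMap {S : A} (hS : IsSequentiallySmall S)
    (x : S ⟶ c.pt) (hx : x ≫ milnorMap F hc = 0) : x = 0 := by
  refine hS.eq_zero_of_comp_coproductProj hc x (fun n ↦ ?_)
  induction n with
  | zero => rw [← milnorMap_coproductProj_zero F hc, reassoc_of% hx, zero_comp]
  | succ n hn =>
    have := x ≫= milnorMap_coproductProj_succ F hc n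
    rw [reassoc_of% hx, zero_comp, Preadditive.comp_sub, reassoc_of% hn, zero_comp,
      sub_zero] at this
    exact this.symm

lemma comp_coproductProj_eq_zero_of_comp_inj_eq_comp_milnorMap {S : A} {n : ℕ} (x : S ⟶ F.obj n)
    (y : S ⟶ c.pt) (h : x ≫ c.inj n = y ≫ milnorMap F hc) (m : ℕ) (hm : m < n) :
    y ≫ coproductProj hc m = 0 := by
  induction m with
  | zero =>
    rw [← milnorMap_coproductProj_zero F hc, ← reassoc_of% h,
      inj_coproductProj_of_ne hc hm.ne', comp_zero]
  | succ m ih =>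
    have := y ≫= milnorMap_coproductProj_succ F hc m
    rw [← reassoc_of% h, inj_coproductProj_of_ne hc hm.ne', comp_zero, Preadditive.comp_sub,
      reassoc_of% (ih (by lia)), zero_comp, sub_zero] at this
    exact this.symm

/-- Solving `y (1 - s) = x` degree by degree: `y` is zero below `n`, equals `x` at `n`, and is then
transported by the transition maps. -/
lemma comp_coproductProj_eq_of_comp_inj_eq_comp_milnorMap {S : A} {n : ℕ} (x : S ⟶ F.obj n)
    (y : S ⟶ c.pt) (h : x ≫ c.inj n = y ≫ milnorMap F hc) (m : ℕ) (hm : n ≤ m) :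
    y ≫ coproductProj hc m = x ≫ F.map (homOfLE hm) := by
  induction m, hm using Nat.le_induction with
  | base =>
    have hx : x = y ≫ milnorMap F hc ≫ coproductProj hc n := by simp [← reassoc_of% h]
    have hid : F.map (homOfLE (le_refl n)) = 𝟙 _ := F.map_id n
    rw [hid, Category.comp_id]
    conv_rhs => rw [hx]
    cases n with
    | zero => rw [milnorMap_coproductProj_zero]
    | succ n =>
      rw [milnorMap_coproductProj_succ, Preadditive.comp_sub, ← Category.assoc,
        comp_coproductProj_eq_zero_of_comp_inj_eq_comp_milnorMap F hc x y h n (by lia),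
        zero_comp, sub_zero]
  | succ m hm ih =>
    have := y ≫= milnorMap_coproductProj_succ F hc m
    rw [← reassoc_of% h, inj_coproductProj_of_ne hc (by lia), comp_zero, Preadditive.comp_sub,
      reassoc_of% ih, eq_comm, sub_eq_zero] at this
    rw [this, ← F.map_comp, homOfLE_comp]

/-- The components of `y` from `n` on are the images of `x`; since `y` has finite support, these are
eventually zero. -/
lemma IsSequentiallySmall.exists_comp_map_eq_zero {S : A} (hS : IsSequentiallySmall S) {n : ℕ}
    (x : S ⟶ F.obj n) (y : S ⟶ c.pt) (h : x ≫ c.inj n = y ≫ milnorMap F hc) :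
    ∃ (m : ℕ) (hm : n ≤ m), x ≫ F.map (homOfLE hm) = 0 := by
  obtain ⟨N, hN⟩ := hS.exists_forall_comp_coproductProj_eq_zero hc y
  refine ⟨max n N, le_max_left _ _, ?_⟩
  rw [← comp_coproductProj_eq_of_comp_inj_eq_comp_milnorMap F hc x y h]
  exact hN _ (le_max_right _ _)

/-- The cocone of a sequence deduced from a morphism killed by `milnorMap`. -/
noncomputable def milnorCocone {M : A} (q : c.pt ⟶ M) (hq : milnorMap F hc ≫ q = 0) : Cocone F where
  pt := M
  ι := NatTrans.ofSequence (fun n ↦ c.inj n ≫ q) (fun n ↦ by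
    have := c.inj n ≫= hq
    rw [inj_milnorMap_assoc, Preadditive.sub_comp, comp_zero, sub_eq_zero] at this
    simpa using this.symm)

lemma map_inj_comp_of_milnorMap_comp {M : A} (q : c.pt ⟶ M) (hq : milnorMap F hc ≫ q = 0)
    {m n : ℕ} (h : m ≤ n) : F.map (homOfLE h) ≫ c.inj n ≫ q = c.inj m ≫ q :=
  (milnorCocone F hc q hq).w (homOfLE h)

lemma milnorMap_desc (s : Cocone F) :
    milnorMap F hc ≫ Cofan.IsColimit.desc hc (fun n ↦ s.ι.app n) = 0 :=
  Cofan.IsColimit.hom_ext hc _ _ (fun n ↦ by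
    simp [inj_milnorMap_assoc, Preadditive.sub_comp])

/-- A cokernel of `milnorMap` is a colimit of the sequence. -/
noncomputable def isColimitMilnorCocone {M : A} (q : c.pt ⟶ M) (hq : milnorMap F hc ≫ q = 0)
    (hM : IsColimit (CokernelCofork.ofπ q hq)) : IsColimit (milnorCocone F hc q hq) where
  desc s := (CokernelCofork.IsColimit.desc' hM _ (milnorMap_desc F hc s)).1
  fac s n := by
    have : q ≫ _ = _ := (CokernelCofork.IsColimit.desc' hM _ (milnorMap_desc F hc s)).2
    change (c.inj n ≫ q) ≫ _ = _
    rw [Category.assoc, this, Cofan.IsColimit.fac]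
  uniq s m hm := Cofork.IsColimit.hom_ext hM
    (Cofan.IsColimit.hom_ext hc _ _ (fun n ↦ by
      have : q ≫ _ = _ := (CokernelCofork.IsColimit.desc' hM _ (milnorMap_desc F hc s)).2
      have hm' : (c.inj n ≫ q) ≫ m = _ := hm n
      change c.inj n ≫ q ≫ m = c.inj n ≫ q ≫ _
      rw [this, Cofan.IsColimit.fac, ← hm']
      exact (Category.assoc _ _ _).symm))

lemma IsSequentiallySmall.exists_comp_eq_of_comp_milnorMap {S : A} (hS : IsSequentiallySmall S)
    {M : A} (q : c.pt ⟶ M) (hq : milnorMap F hc ≫ q = 0) (f : S ⟶ c.pt) :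
    ∃ (n : ℕ) (x : S ⟶ F.obj n), f ≫ q = x ≫ c.inj n ≫ q := by
  obtain ⟨s, g, rfl⟩ := hS c hc f
  let N := s.sup id
  have hN (n : ℕ) (hn : n ∈ s) : n ≤ N := Finset.le_sup (f := id) hn
  -- The finitely many components are pushed to a common stage `N`, which changes nothing after `q`.
  refine ⟨N, ∑ n ∈ s.attach, g n.1 ≫ F.map (homOfLE (hN n.1 n.2)), ?_⟩
  rw [Preadditive.sum_comp, Preadditive.sum_comp, ← Finset.sum_attach]
  refine Finset.sum_congr rfl (fun n _ ↦ ?_)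
  rw [Category.assoc, Category.assoc, map_inj_comp_of_milnorMap_comp F hc q hq (hN n.1 n.2)]

end

end Coproducts

/-! ### Compatibility with shifts -/

section Shift

variable {D : Type u} [Category.{v} D] [Preadditive D] [HasShift D ℤ]
  [∀ n : ℤ, (shiftFunctor D n).Additive]

/-- The shift of a coproduct is a coproduct. -/
noncomputable def isColimitShiftCofan {X : ℕ → D} {c : Cofan X} (hc : IsColimit c) (k : ℤ) :
    IsColimit (Cofan.mk (c.pt⟦k⟧) (fun n ↦ (c.inj n)⟦k⟧') : Cofan (fun n ↦ (X n)⟦k⟧)) :=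
  isColimitCofanMkObjOfIsColimit (shiftFunctor D k) _ _
    (IsColimit.ofIsoColimit hc (Cofan.ext (Iso.refl _)))

lemma IsSequentiallySmall.shift {S : D} (hS : IsSequentiallySmall S) (k : ℤ) :
    IsSequentiallySmall (S⟦k⟧) := by
  intro X c hc f
  let u : S⟦k⟧⟦-k⟧ ≅ S := (shiftEquiv D k).unitIso.symm.app S
  obtain ⟨s, g, hg⟩ := hS _ (isColimitShiftCofan hc (-k)) (u.inv ≫ f⟦-k⟧')
  refine ⟨s, fun n ↦ (shiftFunctor D (-k)).preimage (u.hom ≫ g n),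
    (shiftFunctor D (-k)).map_injective ?_⟩
  rw [Iso.inv_comp_eq] at hg
  rw [hg, Functor.map_sum, Preadditive.comp_sum]
  simp

lemma IsSequentiallySmall.eq_zero_of_comp_shift_milnorMap {S : D} (hS : IsSequentiallySmall S)
    (F : ℕ ⥤ D) {c : Cofan F.obj} (hc : IsColimit c) (k : ℤ) (x : S ⟶ c.pt⟦k⟧)
    (hx : x ≫ (milnorMap F hc)⟦k⟧' = 0) : x = 0 := by
  let u : 𝟭 D ≅ shiftFunctor D k ⋙ shiftFunctor D (-k) := (shiftEquiv D k).unitIso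
  have h : x⟦-k⟧' ≫ u.inv.app c.pt = 0 := by
    refine (hS.shift (-k)).eq_zero_of_comp_milnorMap F hc _ ?_
    have nat : u.inv.app c.pt ≫ milnorMap F hc = (milnorMap F hc)⟦k⟧'⟦-k⟧' ≫ u.inv.app c.pt :=
      (u.inv.naturality (milnorMap F hc)).symm
    rw [Category.assoc, nat, ← Functor.map_comp_assoc, hx, Functor.map_zero, zero_comp]
  exact (shiftFunctor D (-k)).map_injective (by
    rw [← cancel_mono (u.inv.app c.pt), h, Functor.map_zero, zero_comp])

end Shift

end CompactlyGeneratedHeart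

/-! ### The heart is abelian -/

namespace CompactlyGeneratedHeart

open Pretriangulated Triangulated ZeroObject

variable {D : Type u} [Category.{v} D] [Preadditive D] [HasZeroObject D] [HasShift D ℤ]
  [∀ n : ℤ, (shiftFunctor D n).Additive] [Pretriangulated D]

section Heart

variable (t : TStructure D)

instance isLE_obj (X : t.heart.FullSubcategory) : t.IsLE X.obj 0 := ⟨X.property.1⟩

instance isGE_obj (X : t.heart.FullSubcategory) : t.IsGE X.obj 0 := ⟨X.property.2⟩

instance containsZero_heart : t.heart.ContainsZero where
  exists_zero := ⟨0, isZero_zero D, (t.mem_heart_iff _).2 ⟨inferInstance, inferInstance⟩⟩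

lemma heart_prod {X Y : D} (hX : t.heart X) (hY : t.heart Y) : t.heart (X ⨯ Y) := by
  rw [t.mem_heart_iff] at hX hY ⊢
  exact ⟨t.isLE₂ _ (binaryProductTriangle_distinguished X Y) 0 hX.1 hY.1,
    t.isGE₂ _ (binaryProductTriangle_distinguished X Y) 0 hX.2 hY.2⟩

instance isClosedUnderBinaryProducts_heart : t.heart.IsClosedUnderBinaryProducts :=
  .mk' (by
    rintro _ ⟨F, hF⟩
    exact t.heart.prop_of_iso (HasLimit.isoOfNatIso (diagramIsoPair F)).symm
      (heart_prod t (hF _) (hF _)))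

instance isClosedUnderFiniteProducts_heart : t.heart.IsClosedUnderFiniteProducts := .mk'

lemma heart_hom_shift_eq_zero ⦃X Y : t.heart.FullSubcategory⦄ ⦃n : ℤ⦄
    (f : t.heart.ι.obj X ⟶ (t.heart.ι.obj Y)⟦n⟧) (hn : n < 0) : f = 0 := by
  have : t.IsGE ((t.heart.ι.obj Y)⟦n⟧) (-n) := t.isGE_shift Y.obj 0 n (-n)
  exact t.zero_of_isLE_of_isGE f 0 (-n) (by lia) (isLE_obj t X) this

variable [IsTriangulated D]

/-- The cone of a morphism of the heart lives in degrees `-1` and `0`; its truncation triangle `K[1]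
⟶ X₃ ⟶ Q` exhibits the kernel `K` and the cokernel `Q`. -/
lemma admissibleMorphism_heart : AbelianSubcategory.admissibleMorphism t.heart.ι = ⊤ := by
  ext X₁ X₂ f₁
  refine ⟨fun _ ↦ trivial, fun _ X₃ f₂ f₃ hT ↦ ?_⟩
  have : t.IsLE (X₁.obj⟦(1 : ℤ)⟧) (-1) := t.isLE_shift X₁.obj 0 1 (-1)
  have : t.IsGE (X₁.obj⟦(1 : ℤ)⟧) (-1) := t.isGE_shift X₁.obj 0 1 (-1)
  have : t.IsLE X₃ 0 := t.isLE₂ _ (rot_of_distTriang _ hT) 0 (isLE_obj t X₂)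
    (t.isLE_of_le (X₁.obj⟦(1 : ℤ)⟧) (-1) 0)
  have : t.IsGE X₃ (-1) := t.isGE₂ _ (rot_of_distTriang _ hT) (-1)
    (t.isGE_of_ge X₂.obj (-1) 0) (inferInstanceAs (t.IsGE (X₁.obj⟦(1 : ℤ)⟧) (-1)))
  have : t.IsLE ((t.truncLT 0).obj X₃) (-1) := t.isLE_truncLT_obj X₃ 0 (-1)
  let K : t.heart.FullSubcategory := ⟨((t.truncLT 0).obj X₃)⟦(-1 : ℤ)⟧,
    (t.mem_heart_iff _).2 ⟨t.isLE_shift _ (-1) (-1) 0, t.isGE_shift _ (-1) (-1) 0⟩⟩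
  let Q : t.heart.FullSubcategory := ⟨(t.truncGE 0).obj X₃,
    (t.mem_heart_iff _).2 ⟨inferInstance, inferInstance⟩⟩
  let e : (t.heart.ι.obj K)⟦(1 : ℤ)⟧ ≅ (t.truncLT 0).obj X₃ :=
    (shiftEquiv D (1 : ℤ)).counitIso.app _
  refine ⟨K, Q, e.hom ≫ (t.truncLTι 0).app X₃, (t.truncGEπ 0).app X₃,
    (t.truncGEδLT 0).app X₃ ≫ e.inv⟦1⟧', ?_⟩
  refine isomorphic_distinguished _ (t.triangleLTGE_distinguished 0 X₃) _ ?_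
  refine Triangle.isoMk _ _ e (Iso.refl _) (Iso.refl _) ?_ ?_ ?_
  · exact Category.comp_id _
  · exact (Category.comp_id _).trans (Category.id_comp _).symm
  · change ((t.truncGEδLT 0).app X₃ ≫ e.inv⟦1⟧') ≫ e.hom⟦1⟧' = 𝟙 _ ≫ (t.truncGEδLT 0).app X₃
    rw [Category.assoc, ← Functor.map_comp, e.inv_hom_id, CategoryTheory.Functor.map_id,
      Category.id_comp]
    exact Category.comp_id _

/-- The heart of a t-structure is an abelian category. -/
@[reducible]
noncomputable def abelianHeart : Abelian t.heart.FullSubcategory :=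
  AbelianSubcategory.abelian t.heart.ι (heart_hom_shift_eq_zero t) (admissibleMorphism_heart t)

lemma isAbelianCategory_heart : IsAbelianCategory t.heart.FullSubcategory :=
  ⟨abelianHeart t, rfl⟩

end Heart

end CompactlyGeneratedHeart

/-! ### Milnor cones of sequences in the heart -/

namespace CompactlyGeneratedHeart

open Pretriangulated Triangulated ZeroObject

variable {D : Type u} [Category.{v} D] [Preadditive D] [HasZeroObject D] [HasShift D ℤ]
  [∀ n : ℤ, (shiftFunctor D n).Additive] [Pretriangulated D]

/-- Morphisms from a sequentially small object to the cone of `milnorMap` lift to the coproduct. -/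
lemma IsSequentiallySmall.exists_lift_of_milnorMap_distTriang {S : D} (hS : IsSequentiallySmall S)
    (F : ℕ ⥤ D) {c : Cofan F.obj} (hc : IsColimit c) {M : D} {q : c.pt ⟶ M}
    {δ : M ⟶ c.pt⟦(1 : ℤ)⟧} (hT : Triangle.mk (milnorMap F hc) q δ ∈ distTriang D) (x : S ⟶ M) :
    ∃ z : S ⟶ c.pt, x = z ≫ q := by
  have h : δ ≫ (milnorMap F hc)⟦(1 : ℤ)⟧' = 0 := comp_distTriang_mor_zero₃₁ _ hT
  -- The shifted Milnor map kills `x ≫ δ` and is injective on maps from `S`.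
  have hx : x ≫ δ = 0 := hS.eq_zero_of_comp_shift_milnorMap F hc 1 _ (by
    rw [Category.assoc, h, comp_zero])
  exact Triangle.coyoneda_exact₃ _ hT x hx

section Generation

variable {t : TStructure D}

lemma isLE_cofan {X : ℕ → D} {c : Cofan X} (hc : IsColimit c) (n : ℤ)
    (hX : ∀ i, t.IsLE (X i) n) : t.IsLE c.pt n := by
  rw [t.isLE_iff_orthogonal n (n + 1) rfl]
  intro Y f _
  exact Cofan.IsColimit.hom_ext hc _ _ (fun i ↦ by
    rw [comp_zero]
    exact t.zero _ n (n + 1))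

variable {S : ObjectProperty D} (hgen : IsGeneratedBy t S)

include hgen

lemma isGE_one_iff (Y : D) :
    t.IsGE Y 1 ↔ ∀ X : D, S X → ∀ k : ℤ, 0 ≤ k → ∀ f : X⟦k⟧ ⟶ Y, f = 0 := by
  rw [← hgen.2, t.isGE_iff_orthogonal 0 1 rfl]
  exact ⟨fun h X f hX ↦ h X f ⟨hX⟩, fun h X f hX ↦ h f hX.le⟩

lemma isLE_of_generator {X : D} (hX : S X) : t.IsLE X 0 := ⟨hgen.1 X hX⟩

lemma isLE_shift_of_generator {X : D} (hX : S X) {k : ℤ} (hk : 0 ≤ k) : t.IsLE (X⟦k⟧) 0 := by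
  have := isLE_of_generator hgen hX
  have := t.isLE_shift X 0 k (-k)
  exact t.isLE_of_le _ (-k) 0

variable (hS : ∀ X, S X → IsSequentiallySmall X)

include hS

lemma isGE_one_cofan {X : ℕ → D} {c : Cofan X} (hc : IsColimit c)
    (hX : ∀ i, t.IsGE (X i) 1) : t.IsGE c.pt 1 := by
  rw [isGE_one_iff hgen]
  intro Y hY k hk f
  have := isLE_shift_of_generator hgen hY hk
  exact ((hS Y hY).shift k).eq_zero_of_comp_coproductProj hc f (fun n ↦ t.zero _ 0 1)

lemma isGE_zero_cofan {X : ℕ → D} {c : Cofan X} (hc : IsColimit c)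
    (hX : ∀ i, t.IsGE (X i) 0) : t.IsGE c.pt 0 := by
  have : t.IsGE (c.pt⟦(-1 : ℤ)⟧) 1 :=
    isGE_one_cofan hgen hS (isColimitShiftCofan hc (-1)) (fun i ↦ t.isGE_shift (X i) 0 (-1) 1)
  exact t.isGE_of_shift c.pt 0 (-1) 1

lemma heart_cofan {X : ℕ → D} {c : Cofan X} (hc : IsColimit c) (hX : ∀ i, t.heart (X i)) :
    t.heart c.pt := by
  rw [t.mem_heart_iff]
  exact ⟨isLE_cofan hc 0 (fun i ↦ ((t.mem_heart_iff _).1 (hX i)).1),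
    isGE_zero_cofan hgen hS hc (fun i ↦ ((t.mem_heart_iff _).1 (hX i)).2)⟩

/-- The cone of `milnorMap` for a sequence in the heart lies in the heart. -/
lemma heart_of_milnorMap_distTriang (F : ℕ ⥤ D) (hF : ∀ i, t.heart (F.obj i))
    {c : Cofan F.obj} (hc : IsColimit c) {M : D} {q : c.pt ⟶ M} {δ : M ⟶ c.pt⟦(1 : ℤ)⟧}
    (hT : Triangle.mk (milnorMap F hc) q δ ∈ distTriang D) : t.heart M := by
  have hc' := heart_cofan hgen hS hc hF
  rw [t.mem_heart_iff] at hc' ⊢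
  obtain ⟨_, _⟩ := hc'
  have := t.isLE_shift c.pt 0 1 (-1)
  refine ⟨t.isLE₂ _ (rot_of_distTriang _ hT) 0 (inferInstanceAs (t.IsLE c.pt 0))
    (t.isLE_of_le (c.pt⟦(1 : ℤ)⟧) (-1) 0), ?_⟩
  -- The triangle alone only gives `M ≥ -1`; the bound `M ≥ 0` is tested on generators.
  suffices t.IsGE (M⟦(-1 : ℤ)⟧) 1 from t.isGE_of_shift M 0 (-1) 1
  rw [isGE_one_iff hgen]
  intro Y hY k hk f
  have := isLE_shift_of_generator hgen hY hk
  have := t.isLE_shift (Y⟦k⟧) 0 1 (-1)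
  let e : M⟦(-1 : ℤ)⟧⟦(1 : ℤ)⟧ ≅ M := (shiftEquiv D (1 : ℤ)).counitIso.app M
  suffices f⟦(1 : ℤ)⟧' ≫ e.hom = 0 from (shiftFunctor D (1 : ℤ)).map_injective (by
    rw [← cancel_mono e.hom, this, Functor.map_zero, zero_comp])
  -- The lift `g` goes from an object `≤ -1` to the coproduct, which is `≥ 0`, so it vanishes.
  obtain ⟨g, hg⟩ := (((hS Y hY).shift k).shift 1).exists_lift_of_milnorMap_distTriang F hc hT
    (f⟦(1 : ℤ)⟧' ≫ e.hom)
  rw [hg, t.zero g (-1) 0, zero_comp]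

end Generation

/-! ### Sequential colimits in the heart and their exactness -/

section Colimits

variable {t : TStructure D}

/-- Since `X ≤ 0`, its truncation in degrees `≥ 0` lies in the heart and `x` factors through it;
there the monomorphism can be cancelled. Applied to generators, which need not lie in the heart. -/
lemma eq_zero_of_comp_mono_heart {A B : t.heart.FullSubcategory} [IsTriangulated D] (f : A ⟶ B)
    [Mono f] {X : D} [t.IsLE X 0] (x : X ⟶ A.obj) (hx : x ≫ f.hom = 0) : x = 0 := by
  let Y : t.heart.FullSubcategory := ⟨(t.truncGE 0).obj X,
    (t.mem_heart_iff _).2 ⟨inferInstance, inferInstance⟩⟩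
  let y : Y ⟶ A := ObjectProperty.homMk (t.descTruncGE x 0)
  have hy : y ≫ f = 0 := by
    apply t.heart.ι.map_injective
    refine t.from_truncGE_obj_ext (n := 0) (X := X) (Y := B.obj) ?_
    change (t.truncGEπ 0).app X ≫ t.descTruncGE x 0 ≫ f.hom = (t.truncGEπ 0).app X ≫ 0
    rw [comp_zero, ← hx, ← Category.assoc]
    exact congr_arg (· ≫ f.hom) (t.π_descTruncGE x 0)
  have hy' : y = 0 := zero_of_comp_mono f hy
  have : t.descTruncGE x 0 = 0 := t.heart.ι.congr_map hy'
  rw [← t.π_descTruncGE x 0, this, comp_zero]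

variable {S : ObjectProperty D} (hgen : IsGeneratedBy t S)

include hgen

/-- Positive shifts of generators are `≤ -1` and have no maps to `K` anyway, so the case `k = 0`
gives `K ≥ 1`, while `K ≤ 0`. -/
lemma isZero_of_forall_generator_hom_eq_zero (K : t.heart.FullSubcategory)
    (hK : ∀ X, S X → ∀ x : X ⟶ K.obj, x = 0) : IsZero K := by
  have : t.IsGE K.obj 1 := by
    rw [isGE_one_iff hgen]
    intro X hX k hk f
    obtain rfl | hk' := hk.eq_or_lt
    · rw [← cancel_epi ((shiftFunctorZero D ℤ).inv.app X), comp_zero]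
      exact hK X hX _
    · have := isLE_of_generator hgen hX
      have := t.isLE_shift X 0 k (-k)
      exact t.zero f (-k) 0
  have h := t.isZero K.obj 0 1
  rw [IsZero.iff_id_eq_zero] at h ⊢
  exact t.heart.ι.map_injective h

/-- Monomorphisms in the heart are detected by the morphisms from generators. -/
lemma mono_of_forall_generator [IsTriangulated D] {A B : t.heart.FullSubcategory} (f : A ⟶ B)
    (hf : ∀ X, S X → ∀ x : X ⟶ A.obj, x ≫ f.hom = 0 → x = 0) : Mono f := by
  have : HasKernel f := AbelianSubcategory.hasKernel_of_admissibleMorphism (ι := t.heart.ι)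
    (heart_hom_shift_eq_zero t) f (by simp [admissibleMorphism_heart])
  refine Preadditive.mono_of_isZero_kernel f
    (isZero_of_forall_generator_hom_eq_zero hgen _ (fun X hX x ↦ ?_))
  have := isLE_of_generator hgen hX
  refine eq_zero_of_comp_mono_heart (kernel.ι f) x (hf X hX _ ?_)
  have h : (kernel.ι f).hom ≫ f.hom = 0 := t.heart.ι.congr_map (kernel.condition f)
  rw [Category.assoc, h, comp_zero]

variable (hS : ∀ X, S X → IsSequentiallySmall X) [HasColimitsOfShape (Discrete ℕ) D]

include hS

/-- Sequences in the heart have colimits, and morphisms from generators commute with them. -/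
lemma exists_isColimit_sequence (F : ℕ ⥤ t.heart.FullSubcategory) :
    ∃ (c : Cocone F) (_ : IsColimit c), ∀ X, S X →
      (∀ x : X ⟶ c.pt.obj, ∃ (n : ℕ) (y : X ⟶ (F.obj n).obj), x = y ≫ (c.ι.app n).hom) ∧
      (∀ (n : ℕ) (y : X ⟶ (F.obj n).obj), y ≫ (c.ι.app n).hom = 0 →
        ∃ (m : ℕ) (h : n ≤ m), y ≫ (F.map (homOfLE h)).hom = 0) := by
  let G := F ⋙ t.heart.ι
  let c : Cofan G.obj := Cofan.mk (∐ G.obj) (Sigma.ι G.obj)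
  let hc : IsColimit c := coproductIsCoproduct G.obj
  have hG (i : ℕ) : t.heart (G.obj i) := (F.obj i).property
  obtain ⟨M, q, δ, hT⟩ := distinguished_cocone_triangle (milnorMap G hc)
  let P : t.heart.FullSubcategory := ⟨c.pt, heart_cofan hgen hS hc hG⟩
  let Q : t.heart.FullSubcategory := ⟨M, heart_of_milnorMap_distTriang hgen hS G hG hc hT⟩
  let c' : Cofan F.obj := Cofan.mk P (fun n ↦ ObjectProperty.homMk (c.inj n))
  let hc' : IsColimit c' := Cofan.IsColimit.mk c'
    (fun s ↦ ObjectProperty.homMk (Cofan.IsColimit.desc hc (fun n ↦ (s.inj n).hom)))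
    (fun s n ↦ t.heart.ι.map_injective
      (Cofan.IsColimit.fac hc (fun n ↦ (s.inj n).hom) n))
    (fun s m hm ↦ t.heart.ι.map_injective (Cofan.IsColimit.hom_ext hc _ _ (fun n ↦
      (t.heart.ι.congr_map (hm n)).trans
        (Cofan.IsColimit.fac hc (fun n ↦ (s.inj n).hom) n).symm)))
  let q' : P ⟶ Q := ObjectProperty.homMk q
  -- The coproduct in `D` already lies in the heart, so both Milnor maps agree and the triangle
  -- computes the cokernel in the heart.
  have hφ : t.heart.ι.map (milnorMap F hc') = milnorMap G hc :=
    Cofan.IsColimit.hom_ext hc _ _ (fun n ↦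
      (t.heart.ι.congr_map (inj_milnorMap F hc' n)).trans (inj_milnorMap G hc n).symm)
  have hT' : Triangle.mk (t.heart.ι.map (milnorMap F hc')) (t.heart.ι.map q') δ ∈ distTriang D := by
    rw [hφ]
    exact hT
  have hq : milnorMap G hc ≫ q = 0 := comp_distTriang_mor_zero₁₂ _ hT
  have hq' : milnorMap F hc' ≫ q' = 0 := t.heart.ι.map_injective
    (comp_distTriang_mor_zero₁₂ _ hT')
  refine ⟨milnorCocone F hc' q' hq', isColimitMilnorCocone F hc' q' hq'
    (AbelianSubcategory.isColimitCokernelCoforkOfDistTriang (heart_hom_shift_eq_zero t) _ _ _ hT'),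
    fun X hX ↦ ⟨fun (x : X ⟶ M) ↦ ?_, fun n y hy ↦ ?_⟩⟩
  · obtain ⟨z, hz⟩ := (hS X hX).exists_lift_of_milnorMap_distTriang G hc hT x
    obtain ⟨n, y, hy⟩ := (hS X hX).exists_comp_eq_of_comp_milnorMap G hc q hq z
    exact ⟨n, y, hz.trans hy⟩
  -- A map killed by `q` comes from `1 - s`, so it dies at a finite stage.
  · obtain ⟨z, hz⟩ := Triangle.coyoneda_exact₂ _ hT (y ≫ c.inj n)
      ((Category.assoc _ _ _).trans hy)
    exact (hS X hX).exists_comp_map_eq_zero G hc y z hz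

lemma hasColimitsOfShape_nat_heart : HasColimitsOfShape ℕ t.heart.FullSubcategory where
  has_colimit F := by
    obtain ⟨c, hc, _⟩ := exists_isColimit_sequence hgen hS F
    exact ⟨c, hc⟩

lemma exists_eq_comp_ι_of_isColimit {F : ℕ ⥤ t.heart.FullSubcategory} {c : Cocone F}
    (hc : IsColimit c) {X : D} (hX : S X) (x : X ⟶ c.pt.obj) :
    ∃ (n : ℕ) (y : X ⟶ (F.obj n).obj), x = y ≫ (c.ι.app n).hom := by
  obtain ⟨c', hc', h⟩ := exists_isColimit_sequence hgen hS F
  let e := hc.coconePointUniqueUpToIso hc'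
  obtain ⟨n, y, hy⟩ := (h X hX).1 (x ≫ e.hom.hom)
  refine ⟨n, y, ?_⟩
  have h₁ : e.hom.hom ≫ e.inv.hom = 𝟙 _ := t.heart.ι.congr_map e.hom_inv_id
  have h₂ : (c'.ι.app n).hom ≫ e.inv.hom = (c.ι.app n).hom :=
    t.heart.ι.congr_map (hc.comp_coconePointUniqueUpToIso_inv hc' n)
  rw [← h₂, ← reassoc_of% hy, h₁, Category.comp_id]

lemma exists_comp_map_eq_zero_of_isColimit {F : ℕ ⥤ t.heart.FullSubcategory} {c : Cocone F}
    (hc : IsColimit c) {X : D} (hX : S X) {n : ℕ} (y : X ⟶ (F.obj n).obj)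
    (hy : y ≫ (c.ι.app n).hom = 0) :
    ∃ (m : ℕ) (h : n ≤ m), y ≫ (F.map (homOfLE h)).hom = 0 := by
  obtain ⟨c', hc', h⟩ := exists_isColimit_sequence hgen hS F
  refine (h X hX).2 n y ?_
  have h₂ : (c.ι.app n).hom ≫ (hc.coconePointUniqueUpToIso hc').hom.hom = (c'.ι.app n).hom :=
    t.heart.ι.congr_map (hc.comp_coconePointUniqueUpToIso_hom hc' n)
  rw [← h₂, reassoc_of% hy, zero_comp]

variable [IsTriangulated D]

/-- Sequential colimits in the heart preserve monomorphisms. -/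
lemma mono_of_isColimit_sequence {F G : ℕ ⥤ t.heart.FullSubcategory} {c : Cocone F} {d : Cocone G}
    (hc : IsColimit c) (hd : IsColimit d) (α : F ⟶ G) (hα : ∀ n, Mono (α.app n))
    (f : c.pt ⟶ d.pt) (hf : ∀ n, c.ι.app n ≫ f = α.app n ≫ d.ι.app n) : Mono f := by
  refine mono_of_forall_generator hgen f (fun X hX x hx ↦ ?_)
  have := isLE_of_generator hgen hX
  obtain ⟨n, y, rfl⟩ := exists_eq_comp_ι_of_isColimit hgen hS hc hX x
  have hf' : (c.ι.app n).hom ≫ f.hom = (α.app n).hom ≫ (d.ι.app n).hom :=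
    t.heart.ι.congr_map (hf n)
  obtain ⟨m, h, hy⟩ := exists_comp_map_eq_zero_of_isColimit hgen hS hd hX (y ≫ (α.app n).hom)
    (by rw [Category.assoc, ← hf', ← Category.assoc, hx])
  have nat : (F.map (homOfLE h)).hom ≫ (α.app m).hom = (α.app n).hom ≫ (G.map (homOfLE h)).hom :=
    t.heart.ι.congr_map (α.naturality (homOfLE h))
  -- The image of `y` in `G` dies at stage `m`; as `α.app m` is mono, `y` itself dies there in `F`.
  have hy' := eq_zero_of_comp_mono_heart (α.app m) (y ≫ (F.map (homOfLE h)).hom)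
    (by rw [Category.assoc, nat, ← Category.assoc, hy])
  have w : (F.map (homOfLE h)).hom ≫ (c.ι.app m).hom = (c.ι.app n).hom :=
    t.heart.ι.congr_map (c.w (homOfLE h))
  rw [← w, reassoc_of% hy', zero_comp]

/-- Colimit functors are right exact, so in the abelian heart preserving monomorphisms suffices over
`ℕ`; the result passes to `I` along a final functor `ℕ ⥤ I`. -/
lemma colimitsAreExact_heart (I : Type w) [Preorder I] [IsDirectedOrder I] [Nonempty I]
    [Countable I] : ColimitsAreExact I t.heart.FullSubcategory := by
  let _ := abelianHeart t
  have := hasColimitsOfShape_nat_heart hgen hS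
  have : Functor.PreservesMonomorphisms (colim (J := ℕ) (C := t.heart.FullSubcategory)) :=
    ⟨fun {F G} α hα ↦ mono_of_isColimit_sequence hgen hS (colimit.isColimit F)
      (colimit.isColimit G) α ((NatTrans.mono_iff_mono_app α).1 hα) _ (fun n ↦ ι_colimMap α n)⟩
  have := hasExactColimitsOfShape_of_preservesMono (C := t.heart.FullSubcategory) ℕ
  have : HasColimitsOfShape I t.heart.FullSubcategory :=
    Functor.Final.hasColimitsOfShape_of_final (IsFiltered.sequentialFunctor I)
  have := hasExactColimitsOfShape_of_final t.heart.FullSubcategory (IsFiltered.sequentialFunctor I)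
  exact ⟨inferInstance, inferInstance, inferInstance⟩

end Colimits

end CompactlyGeneratedHeart

theorem mainTheorem2 {D : Type u} [Category.{v} D] [Preadditive D] [HasZeroObject D]
    [HasShift D ℤ] [∀ n : ℤ, (shiftFunctor D n).Additive] [Pretriangulated D]
    [IsTriangulated D] [HasCoproducts.{v} D]
    (t : Triangulated.TStructure D)
    (ht : CompactlyGeneratedHeart.IsCompactlyGenerated t) :
    CompactlyGeneratedHeart.IsAbelianCategory t.heart.FullSubcategory ∧
      ∀ (I : Type w) [Preorder I] [IsDirectedOrder I] [Nonempty I] [Countable I],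
        CompactlyGeneratedHeart.ColimitsAreExact I t.heart.FullSubcategory := by
  obtain ⟨S, _, hS, hgen⟩ := ht
  have : HasColimitsOfShape (Discrete ℕ) D :=
    hasColimitsOfShape_of_equivalence (Discrete.equivalence (Equiv.ulift.{v} (α := ℕ)))
  exact ⟨CompactlyGeneratedHeart.isAbelianCategory_heart t, fun I _ _ _ _ ↦
    CompactlyGeneratedHeart.colimitsAreExact_heart hgen
      (fun X hX ↦ (hS X hX).isSequentiallySmall) I⟩
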